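/- Let $U\subseteq\mathbb R^N$ be open, with coordinates $u=(u^1,\dots,u^N)$, and let $g_1^{ij}(u)$, $g_2^{ij}(u)$ be two smooth contravariant Riemannian or pseudo-Riemannian metrics on $U$ (symmetric, nondegenerate at every point, of arbitrary signature). For a contravariant metric $g^{ij}$ with inverse $g_{ij}$, let $\Gamma^i_{jk}$ be its Levi-Civita coefficients, $R^i_{jkl}=\partial_k\Gamma^i_{jl}-\partial_l\Gamma^i_{jk}+\Gamma^i_{pk}\Gamma^p_{jl}-\Gamma^i_{pl}\Gamma^p_{jk}$ its curvature tensor, and put $\Gamma^{ij}_k=g^{is}\Gamma^j_{sk}$, $R^{ij}_{kl}=g^{is}R^j_{skl}$ (summation over repeated indices). The metrics $g_1,g_2$ are called *almost compatible* if for all real constants $\lambda_1,\lambda_2$ such that $g^{ij}=\lambda_1g_1^{ij}+\lambda_2g_2^{ij}$ satisfies $\det(g^{ij})\not\equiv0$, one has, wherever $\det (g^{ij}(u))\ne0$, $$\Gamma^{ij}_k=\lambda_1\Gamma^{ij}_{1,k}+\lambda_2\Gamma^{ij}_{2,k};$$ they are called *compatible* if, for all such constants and at all such points, in addition $$R^{ij}_{kl}=\lambda_1R^{ij}_{1,kl}+\lambda_2R^{ij}_{2,kl}.$$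 The pair is called *nonsingular* if at every $u\in U$ the equation $\det(g_1^{ij}(u)-\lambda g_2^{ij}(u))=0$ has $N$ distinct (in general complex) roots $\lambda$. The Nijenhuis tensor of the affinor $v^i_j=g_1^{is}g_{2,sj}$ is $$N^k_{ij}=v^s_i\frac{\partial v^k_j}{\partial u^s}-v^s_j\frac{\partial v^k_i}{\partial u^s}+v^k_s\frac{\partial v^s_i}{\partial u^j}-v^k_s\frac{\partial v^s_j}{\partial u^i}.$$ 1) If $g_1$ and $g_2$ are almost compatible, then the Nijenhuis tensor of $v$ vanishes on $U$. Thus it vanishes for any two compatible or almost compatible metrics. 2) If the pair $g_1,g_2$ is nonsingular and the Nijenhuis tensor of $v$ vanishes on $U$, then $g_1$ and $g_2$ are compatible. Thus a nonsingular pair of metrics is compatible if and only if it is almost compatible. -/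

import Mathlib

/-!
Contravariant (pseudo-)Riemannian metrics on an open domain `U` of `ℝ^N` with coordinates
`u = (u^1, …, u^N)`.  A contravariant metric `g^{ij}(u)` is a matrix-valued function `g`, and
the covariant metric `g_{ij}(u)` is the pointwise inverse matrix `(g u)⁻¹`.
-/

namespace MetricPencil

open scoped ContDiff

noncomputable section

/-- A field of `N × N` matrices in the coordinates `u = (u^1, …, u^N)`. -/
abbrev MatrixField (N : ℕ) : Type := (Fin N → ℝ) → Matrix (Fin N) (Fin N) ℝ

/-- The partial derivative `∂f/∂u^k` at `u`. -/
def pd {N : ℕ} (k : Fin N) (f : (Fin N → ℝ) → ℝ) (u : Fin N → ℝ) : ℝ :=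
  fderiv ℝ f u (Pi.single k 1)

/-- `g` is a smooth contravariant Riemannian or pseudo-Riemannian metric on `U`: symmetric and
nondegenerate, of arbitrary signature. -/
structure IsMetricOn {N : ℕ} (U : Set (Fin N → ℝ)) (g : MatrixField N) : Prop where
  smooth : ∀ i j, ContDiffOn ℝ ∞ (fun u => g u i j) U
  symm : ∀ u ∈ U, (g u).IsSymm
  nondegenerate : ∀ u ∈ U, (g u).det ≠ 0

/-- The Levi-Civita coefficients
`Γ^i_{jk} = (1/2) g^{is} (∂g_{sk}/∂u^j + ∂g_{js}/∂u^k - ∂g_{jk}/∂u^s)`. -/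
def christoffel {N : ℕ} (g : MatrixField N) (i j k : Fin N) (u : Fin N → ℝ) : ℝ :=
  (1 / 2) * ∑ s, g u i s *
    (pd j (fun w => (g w)⁻¹ s k) u + pd k (fun w => (g w)⁻¹ j s) u
      - pd s (fun w => (g w)⁻¹ j k) u)

/-- The coefficients with a raised index, `Γ^{ij}_k = g^{is} Γ^j_{sk}`. -/
def christoffelUp {N : ℕ} (g : MatrixField N) (i j k : Fin N) (u : Fin N → ℝ) : ℝ :=
  ∑ s, g u i s * christoffel g j s k u

/-- The Riemannian curvature tensor
`R^i_{jkl} = ∂Γ^i_{jl}/∂u^k - ∂Γ^i_{jk}/∂u^l + Γ^i_{pk} Γ^p_{jl} - Γ^i_{pl} Γ^p_{jk}`. -/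
def riemann {N : ℕ} (g : MatrixField N) (i j k l : Fin N) (u : Fin N → ℝ) : ℝ :=
  pd k (christoffel g i j l) u - pd l (christoffel g i j k) u
    + ∑ p, christoffel g i p k u * christoffel g p j l u
    - ∑ p, christoffel g i p l u * christoffel g p j k u

/-- The curvature tensor with a raised index, `R^{ij}_{kl} = g^{is} R^j_{skl}`. -/
def riemannUp {N : ℕ} (g : MatrixField N) (i j k l : Fin N) (u : Fin N → ℝ) : ℝ :=
  ∑ s, g u i s * riemann g j s k l u

/-- The linear combination `λ₁ g₁^{ij} + λ₂ g₂^{ij}` with constant coefficients. -/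
def combination {N : ℕ} (c₁ c₂ : ℝ) (g₁ g₂ : MatrixField N) : MatrixField N :=
  fun u => c₁ • g₁ u + c₂ • g₂ u

/-- `Γ^{ij}_k = λ₁ Γ^{ij}_{1,k} + λ₂ Γ^{ij}_{2,k}` at the point `u`. -/
def ConnectionLinearAt {N : ℕ} (c₁ c₂ : ℝ) (g₁ g₂ : MatrixField N) (u : Fin N → ℝ) : Prop :=
  ∀ i j k, christoffelUp (combination c₁ c₂ g₁ g₂) i j k u =
    c₁ * christoffelUp g₁ i j k u + c₂ * christoffelUp g₂ i j k u

/-- `R^{ij}_{kl} = λ₁ R^{ij}_{1,kl} + λ₂ R^{ij}_{2,kl}` at the point `u`. -/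
def CurvatureLinearAt {N : ℕ} (c₁ c₂ : ℝ) (g₁ g₂ : MatrixField N) (u : Fin N → ℝ) : Prop :=
  ∀ i j k l, riemannUp (combination c₁ c₂ g₁ g₂) i j k l u =
    c₁ * riemannUp g₁ i j k l u + c₂ * riemannUp g₂ i j k l u

/-- Almost compatibility: for all constants `λ₁, λ₂` whose combination is not identically
degenerate, the connection relation holds wherever the combination is a metric, i.e. at all
points where its determinant is nonzero (there are none if it is identically degenerate). -/
def AlmostCompatible {N : ℕ} (U : Set (Fin N → ℝ)) (g₁ g₂ : MatrixField N) : Prop :=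
  ∀ c₁ c₂ : ℝ, ∀ u ∈ U, (combination c₁ c₂ g₁ g₂ u).det ≠ 0 →
    ConnectionLinearAt c₁ c₂ g₁ g₂ u

/-- Compatibility: the connection relation and the curvature relation both hold, for all
constants and wherever the combination is nondegenerate. -/
def Compatible {N : ℕ} (U : Set (Fin N → ℝ)) (g₁ g₂ : MatrixField N) : Prop :=
  ∀ c₁ c₂ : ℝ, ∀ u ∈ U, (combination c₁ c₂ g₁ g₂ u).det ≠ 0 →
    ConnectionLinearAt c₁ c₂ g₁ g₂ u ∧ CurvatureLinearAt c₁ c₂ g₁ g₂ u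

/-- At every point of `U` the equation `det (g₁^{ij} - λ g₂^{ij}) = 0`, of degree `N` in `λ`,
has `N` distinct (in general complex) roots. -/
def NonsingularPair {N : ℕ} (U : Set (Fin N → ℝ)) (g₁ g₂ : MatrixField N) : Prop :=
  ∀ u ∈ U,
    {z : ℂ | ((g₁ u).map Complex.ofReal - z • (g₂ u).map Complex.ofReal).det = 0}.ncard = N

/-- The affinor `v^i_j = g₁^{is} g_{2,sj}`. -/
def affinor {N : ℕ} (g₁ g₂ : MatrixField N) : MatrixField N :=
  fun u => g₁ u * (g₂ u)⁻¹

/-- The Nijenhuis tensor of an affinor `v^i_j` (entry `v u i j`),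
`N^k_{ij} = v^s_i ∂v^k_j/∂u^s - v^s_j ∂v^k_i/∂u^s + v^k_s ∂v^s_i/∂u^j - v^k_s ∂v^s_j/∂u^i`. -/
def nijenhuis {N : ℕ} (v : MatrixField N) (k i j : Fin N) (u : Fin N → ℝ) : ℝ :=
  ∑ s, (v u s i * pd s (fun w => v w k j) u - v u s j * pd s (fun w => v w k i) u
    + v u k s * pd j (fun w => v w s i) u - v u k s * pd i (fun w => v w s j) u)

/-- The Nijenhuis tensor of `v` vanishes on `U`. -/
def NijenhuisVanishes {N : ℕ} (U : Set (Fin N → ℝ)) (v : MatrixField N) : Prop :=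
  ∀ u ∈ U, ∀ k i j, nijenhuis v k i j u = 0

end

end MetricPencil

namespace MetricPencil

open scoped ContDiff Topology Matrix

variable {N : ℕ}

/-! Everything reduces to the difference tensor `S = Γ₂ - Γ₁`, through one pointwise condition,
`DifferenceSymmetricAt`: for each `j` the matrix `g₁ S^j g₂` is symmetric.

This condition is equivalent to linearity of the connection. A Levi-Civita connection is determined
by metricity and zero torsion, and in contravariant form torsion-freeness says that `g Γ^j g` is
symmetric. For `c₁ Γ₁^{ij}_k + c₂ Γ₂^{ij}_k`, metricity with respect to the combined metric is
automatic, and the failure of the symmetry is `c₁ c₂` times the skew part of `g₁ S^j g₂`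
(`skew_part_eq`).

It is also equivalent to the vanishing of the Nijenhuis tensor. Differentiating `v g₂ = g₁` and
using metricity expresses that tensor through `S` alone (`sum_nijenhuis_affinor_eq`), as a signed
cyclic sum of the skew part of `g₁ S g₂`. Rotating the arguments isolates each term
(`nijenhuis_affinor_eq_zero_iff`).

For curvature, `riemannUp_eq` leaves derivatives of `Γ^{ij}_k`, which are now linear, and the skew
part of `Γ^i g Γ^j`. The latter deviates from linearity by `S^i H S^j`, with `H` built from `g` and
`g₂`. After factoring out `g₂⁻¹`, all factors commute with `v`. Since `v` has distinct eigenvalues,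
they commute with each other, so `S^i H S^j` is symmetric and drops out. -/

/-- The entrywise partial derivative of a matrix field. -/
noncomputable def pdMatrix (k : Fin N) (A : MatrixField N) (u : Fin N → ℝ) :
    Matrix (Fin N) (Fin N) ℝ :=
  Matrix.of fun i j => pd k (fun w => A w i j) u

/-- All entries of a matrix field are differentiable at a point. -/
def EntryDifferentiableAt (A : MatrixField N) (u : Fin N → ℝ) : Prop :=
  ∀ i j, DifferentiableAt ℝ (fun w => A w i j) u

/-! ### Calculus of matrix fields. -/

theorem pd_congr {f f' : (Fin N → ℝ) → ℝ} {u : Fin N → ℝ} (h : f =ᶠ[𝓝 u] f') (k : Fin N) :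
    pd k f u = pd k f' u := by
  rw [pd, pd, h.fderiv_eq]

theorem pd_sum {ι : Type*} (s : Finset ι) (k : Fin N) {f : ι → (Fin N → ℝ) → ℝ}
    {u : Fin N → ℝ} (hf : ∀ i ∈ s, DifferentiableAt ℝ (f i) u) :
    pd k (fun w => ∑ i ∈ s, f i w) u = ∑ i ∈ s, pd k (f i) u := by
  simp only [pd]
  rw [fderiv_fun_sum hf, sum_apply]

theorem pd_mul (k : Fin N) {f f' : (Fin N → ℝ) → ℝ} {u : Fin N → ℝ}
    (hf : DifferentiableAt ℝ f u) (hf' : DifferentiableAt ℝ f' u) :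
    pd k (fun w => f w * f' w) u = pd k f u * f' u + f u * pd k f' u := by
  simp only [pd]
  rw [fderiv_fun_mul hf hf']
  simp
  ring

theorem pd_linear_combination (k : Fin N) (c c' : ℝ) {f f' : (Fin N → ℝ) → ℝ} {u : Fin N → ℝ}
    (hf : DifferentiableAt ℝ f u) (hf' : DifferentiableAt ℝ f' u) :
    pd k (fun w => c * f w + c' * f' w) u = c * pd k f u + c' * pd k f' u := by
  simp only [pd]
  rw [fderiv_fun_add (hf.const_mul c) (hf'.const_mul c'), fderiv_const_mul hf,
    fderiv_const_mul hf']
  simp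

theorem pdMatrix_congr {A B : MatrixField N} {u : Fin N → ℝ} (h : A =ᶠ[𝓝 u] B) (k : Fin N) :
    pdMatrix k A u = pdMatrix k B u := by
  ext i j
  exact pd_congr (h.mono fun w hw => by simp only [hw]) k

theorem pdMatrix_mul (k : Fin N) {A B : MatrixField N} {u : Fin N → ℝ}
    (hA : EntryDifferentiableAt A u) (hB : EntryDifferentiableAt B u) :
    pdMatrix k (fun w => A w * B w) u = pdMatrix k A u * B u + A u * pdMatrix k B u := by
  ext i j
  simp only [pdMatrix, Matrix.of_apply, Matrix.mul_apply, Matrix.add_apply]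
  rw [pd_sum _ _ fun s _ => (hA i s).fun_mul (hB s j), ← Finset.sum_add_distrib]
  exact Finset.sum_congr rfl fun s _ => pd_mul k (hA i s) (hB s j)

theorem pdMatrix_const (k : Fin N) (M : Matrix (Fin N) (Fin N) ℝ) (u : Fin N → ℝ) :
    pdMatrix k (fun _ => M) u = 0 := by
  ext i j
  simp [pdMatrix, pd]

theorem contDiffOn_pd {U : Set (Fin N → ℝ)} (hU : IsOpen U) {f : (Fin N → ℝ) → ℝ}
    (hf : ContDiffOn ℝ ∞ f U) (k : Fin N) : ContDiffOn ℝ ∞ (pd k f) U :=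
  (hf.fderiv_of_isOpen hU (m := ∞) (by simp)).clm_apply contDiffOn_const

theorem contDiffOn_det {U : Set (Fin N → ℝ)} {A : MatrixField N}
    (hA : ∀ i j, ContDiffOn ℝ ∞ (fun u => A u i j) U) :
    ContDiffOn ℝ ∞ (fun u => (A u).det) U := by
  simp only [Matrix.det_apply']
  exact ContDiffOn.sum fun σ _ => contDiffOn_const.mul (contDiffOn_prod fun i _ => hA _ _)

theorem contDiffOn_inv {U : Set (Fin N → ℝ)} {A : MatrixField N}
    (hA : ∀ i j, ContDiffOn ℝ ∞ (fun u => A u i j) U) (hdet : ∀ u ∈ U, (A u).det ≠ 0)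
    (i j : Fin N) : ContDiffOn ℝ ∞ (fun u => (A u)⁻¹ i j) U := by
  simp only [Matrix.inv_def, Ring.inverse_eq_inv', Matrix.smul_apply, smul_eq_mul,
    Matrix.adjugate_apply]
  refine ((contDiffOn_det hA).inv hdet).mul (contDiffOn_det fun a b => ?_)
  simp only [Matrix.updateRow_apply]
  split_ifs
  · exact contDiffOn_const
  · exact hA a b

/-! ### Levi-Civita connection and curvature in contravariant form. -/

/-- The matrix `(Γ^j_{sk})_{sk}` of the Levi-Civita coefficients with upper index `j`. -/
noncomputable def gammaMatrix (g : MatrixField N) (j : Fin N) (u : Fin N → ℝ) :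
    Matrix (Fin N) (Fin N) ℝ :=
  Matrix.of fun s k => christoffel g j s k u

theorem christoffelUp_eq (g : MatrixField N) (i j k : Fin N) (u : Fin N → ℝ) :
    christoffelUp g i j k u = (g u * gammaMatrix g j u) i k := by
  simp [christoffelUp, gammaMatrix, Matrix.mul_apply]

namespace IsMetricOn

variable {U : Set (Fin N → ℝ)} {g : MatrixField N} {u : Fin N → ℝ}

theorem mono {V : Set (Fin N → ℝ)} (h : IsMetricOn U g) (hV : V ⊆ U) : IsMetricOn V g :=
  ⟨fun i j => (h.smooth i j).mono hV, fun u hu => h.symm u (hV hu),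
    fun u hu => h.nondegenerate u (hV hu)⟩

theorem isUnit_det (h : IsMetricOn U g) (hu : u ∈ U) : IsUnit (g u).det :=
  (h.nondegenerate u hu).isUnit

theorem entryDifferentiableAt (h : IsMetricOn U g) (hU : IsOpen U) (hu : u ∈ U) :
    EntryDifferentiableAt g u := fun i j =>
  ((h.smooth i j).contDiffAt (hU.mem_nhds hu)).differentiableAt (by simp)

theorem contDiffOn_inv (h : IsMetricOn U g) (i j : Fin N) :
    ContDiffOn ℝ ∞ (fun u => (g u)⁻¹ i j) U :=
  MetricPencil.contDiffOn_inv h.smooth h.nondegenerate i j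

theorem entryDifferentiableAt_inv (h : IsMetricOn U g) (hU : IsOpen U) (hu : u ∈ U) :
    EntryDifferentiableAt (fun w => (g w)⁻¹) u := fun i j =>
  ((h.contDiffOn_inv i j).contDiffAt (hU.mem_nhds hu)).differentiableAt (by simp)

theorem pd_inv_symm (h : IsMetricOn U g) (hU : IsOpen U) (hu : u ∈ U) (k i j : Fin N) :
    pd k (fun w => (g w)⁻¹ i j) u = pd k (fun w => (g w)⁻¹ j i) u :=
  pd_congr (Filter.eventually_of_mem (hU.mem_nhds hu) fun w hw => (h.symm w hw).inv.apply j i) k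

theorem contDiffOn_christoffel (h : IsMetricOn U g) (hU : IsOpen U) (i j k : Fin N) :
    ContDiffOn ℝ ∞ (christoffel g i j k) U := by
  refine contDiffOn_const.mul (ContDiffOn.sum fun s _ => (h.smooth i s).mul ?_)
  exact ((contDiffOn_pd hU (h.contDiffOn_inv s k) j).add
    (contDiffOn_pd hU (h.contDiffOn_inv j s) k)).sub
      (contDiffOn_pd hU (h.contDiffOn_inv j k) s)

theorem differentiableAt_christoffel (h : IsMetricOn U g) (hU : IsOpen U) (hu : u ∈ U)
    (i j k : Fin N) : DifferentiableAt ℝ (christoffel g i j k) u :=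
  ((h.contDiffOn_christoffel hU i j k).contDiffAt (hU.mem_nhds hu)).differentiableAt (by simp)

theorem differentiableAt_christoffelUp (h : IsMetricOn U g) (hU : IsOpen U) (hu : u ∈ U)
    (i j k : Fin N) : DifferentiableAt ℝ (christoffelUp g i j k) u :=
  DifferentiableAt.fun_sum fun s _ =>
    (h.entryDifferentiableAt hU hu i s).fun_mul (h.differentiableAt_christoffel hU hu j s k)

theorem christoffel_symm (h : IsMetricOn U g) (hU : IsOpen U) (hu : u ∈ U) (i j k : Fin N) :
    christoffel g i j k u = christoffel g i k j u := by
  unfold christoffel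
  congr 1
  refine Finset.sum_congr rfl fun s _ => ?_
  rw [h.pd_inv_symm hU hu j s k, h.pd_inv_symm hU hu k j s, h.pd_inv_symm hU hu s j k]
  ring

theorem gammaMatrix_isSymm (h : IsMetricOn U g) (hU : IsOpen U) (hu : u ∈ U) (j : Fin N) :
    (gammaMatrix g j u).IsSymm :=
  Matrix.IsSymm.ext fun a b => h.christoffel_symm hU hu j b a

theorem pdMatrix_eq (h : IsMetricOn U g) (hU : IsOpen U) (hu : u ∈ U) (k : Fin N) :
    pdMatrix k g u = -(g u * pdMatrix k (fun w => (g w)⁻¹) u * g u) := by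
  have hc : pdMatrix k (fun w => g w * (g w)⁻¹) u = 0 := by
    rw [pdMatrix_congr (B := fun _ => 1) (Filter.eventually_of_mem (hU.mem_nhds hu) fun w hw =>
      Matrix.mul_nonsing_inv _ (h.isUnit_det hw)) k, pdMatrix_const]
  rw [pdMatrix_mul k (h.entryDifferentiableAt hU hu) (h.entryDifferentiableAt_inv hU hu)] at hc
  calc pdMatrix k g u = pdMatrix k g u * (g u)⁻¹ * g u := by
        rw [Matrix.mul_assoc, Matrix.nonsing_inv_mul _ (h.isUnit_det hu), Matrix.mul_one]
    _ = _ := by rw [eq_neg_of_add_eq_zero_left hc, Matrix.neg_mul]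

/-- The Levi-Civita connection is metric: `∂_k g^{ij} = - Γ^{ij}_k - Γ^{ji}_k`. -/
theorem pd_eq (h : IsMetricOn U g) (hU : IsOpen U) (hu : u ∈ U) (i j k : Fin N) :
    pd k (fun w => g w i j) u = -(christoffelUp g i j k u + christoffelUp g j i k u) := by
  have key : ∀ i j, christoffelUp g i j k u = ∑ s, ∑ t, g u i s * g u j t *
      ((1 / 2) * (pd s (fun w => (g w)⁻¹ t k) u + pd k (fun w => (g w)⁻¹ s t) u
        - pd t (fun w => (g w)⁻¹ s k) u)) := fun i j => by
    simp only [christoffelUp, christoffel, Finset.mul_sum]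
    refine Finset.sum_congr rfl fun s _ => Finset.sum_congr rfl fun t _ => ?_
    ring
  have hk := congrFun (congrFun (h.pdMatrix_eq hU hu k) i) j
  simp only [pdMatrix, Matrix.of_apply, Matrix.neg_apply, Matrix.mul_apply, Finset.sum_mul] at hk
  rw [hk, key i j, key j i, neg_inj, Finset.sum_comm (f := fun s t => g u j s * g u i t * _),
    ← Finset.sum_add_distrib, Finset.sum_comm]
  refine Finset.sum_congr rfl fun s _ => ?_
  rw [← Finset.sum_add_distrib]
  refine Finset.sum_congr rfl fun t _ => ?_
  rw [h.pd_inv_symm hU hu k t s, (h.symm u hu).apply j t]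
  ring

/-- The curvature tensor in terms of the contravariant Levi-Civita coefficients. -/
theorem riemannUp_eq (h : IsMetricOn U g) (hU : IsOpen U) (hu : u ∈ U) (i j k l : Fin N) :
    riemannUp g i j k l u =
      pd k (christoffelUp g i j l) u - pd l (christoffelUp g i j k) u
        + (gammaMatrix g i u * g u * gammaMatrix g j u) k l
        - (gammaMatrix g i u * g u * gammaMatrix g j u) l k := by
  -- Product rule, with `∂_k g^{is}` replaced by metricity. Of the two resulting products, `Γ^{is}_k
  -- Γ^j_{sl}` cancels against the quadratic terms of the curvature, and `Γ^{si}_k Γ^j_{sl}`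
  -- survives as `Γ^i g Γ^j`.
  have hpd : ∀ k l, pd k (christoffelUp g i j l) u =
      ∑ s, g u i s * pd k (christoffel g j s l) u
        - ∑ s, (christoffelUp g i s k u + christoffelUp g s i k u) * christoffel g j s l u :=
      fun k l => by
    rw [← Finset.sum_sub_distrib]
    unfold christoffelUp
    rw [pd_sum _ _ fun s _ =>
      (h.entryDifferentiableAt hU hu i s).fun_mul (h.differentiableAt_christoffel hU hu j s l)]
    refine Finset.sum_congr rfl fun s _ => ?_
    rw [pd_mul k (h.entryDifferentiableAt hU hu i s) (h.differentiableAt_christoffel hU hu j s l),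
      h.pd_eq hU hu]
    unfold christoffelUp
    ring
  have hquad : ∀ k l, (gammaMatrix g i u * g u * gammaMatrix g j u) k l =
      ∑ s, christoffelUp g s i k u * christoffel g j s l u := fun k l => by
    have hT : gammaMatrix g i u * g u = (g u * gammaMatrix g i u)ᵀ := by
      rw [Matrix.transpose_mul, (h.gammaMatrix_isSymm hU hu i).eq, (h.symm u hu).eq]
    rw [hT, Matrix.mul_apply]
    exact Finset.sum_congr rfl fun s _ => by
      rw [Matrix.transpose_apply, christoffelUp_eq, gammaMatrix, gammaMatrix, Matrix.of_apply]
  have hprod : ∀ k l, ∑ s, g u i s * ∑ p, christoffel g j p k u * christoffel g p s l u =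
      ∑ p, christoffelUp g i p l u * christoffel g j p k u := fun k l => by
    simp only [Finset.mul_sum, christoffelUp, Finset.sum_mul]
    rw [Finset.sum_comm]
    exact Finset.sum_congr rfl fun p _ => Finset.sum_congr rfl fun s _ => by ring
  simp only [riemannUp, riemann, mul_sub, mul_add, Finset.sum_sub_distrib, Finset.sum_add_distrib]
  rw [hprod, hprod, hpd, hpd, hquad, hquad]
  simp only [add_mul, Finset.sum_add_distrib]
  ring

end IsMetricOn

/-! ### The difference tensor and linearity of the connection. -/

/-- The matrices `(S^j_{sk})_{sk}` of the difference tensor `S = Γ₂ - Γ₁` of two Levi-Civita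
connections. -/
noncomputable def differenceMatrix (g₁ g₂ : MatrixField N) (j : Fin N) (u : Fin N → ℝ) :
    Matrix (Fin N) (Fin N) ℝ :=
  gammaMatrix g₂ j u - gammaMatrix g₁ j u

/-- The tensor `g₁^{is} S^j_{sp} g₂^{pk}` is symmetric in `i` and `k`. -/
def DifferenceSymmetricAt (g₁ g₂ : MatrixField N) (u : Fin N → ℝ) : Prop :=
  ∀ j, g₁ u * differenceMatrix g₁ g₂ j u * g₂ u = g₂ u * differenceMatrix g₁ g₂ j u * g₁ u

theorem connectionLinearAt_iff {c₁ c₂ : ℝ} {g₁ g₂ : MatrixField N} {u : Fin N → ℝ} :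
    ConnectionLinearAt c₁ c₂ g₁ g₂ u ↔ ∀ j,
      combination c₁ c₂ g₁ g₂ u * gammaMatrix (combination c₁ c₂ g₁ g₂) j u =
        c₁ • (g₁ u * gammaMatrix g₁ j u) + c₂ • (g₂ u * gammaMatrix g₂ j u) := by
  simp only [ConnectionLinearAt, christoffelUp_eq, ← Matrix.ext_iff, Matrix.add_apply,
    Matrix.smul_apply, smul_eq_mul]
  exact ⟨fun h j i k => h i j k, fun h i j k => h j i k⟩

theorem isOpen_det_ne_zero {U : Set (Fin N → ℝ)} (hU : IsOpen U) {A : MatrixField N}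
    (hA : ∀ i j, ContDiffOn ℝ ∞ (fun u => A u i j) U) : IsOpen {u ∈ U | (A u).det ≠ 0} :=
  (contDiffOn_det hA).continuousOn.isOpen_inter_preimage hU isOpen_ne

theorem contDiffOn_combination {U : Set (Fin N → ℝ)} {g₁ g₂ : MatrixField N} (c₁ c₂ : ℝ)
    (h₁ : IsMetricOn U g₁) (h₂ : IsMetricOn U g₂) (i j : Fin N) :
    ContDiffOn ℝ ∞ (fun u => combination c₁ c₂ g₁ g₂ u i j) U := by
  simp only [combination, Matrix.add_apply, Matrix.smul_apply, smul_eq_mul]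
  exact (contDiffOn_const.mul (h₁.smooth i j)).add (contDiffOn_const.mul (h₂.smooth i j))

/-- A combination of two metrics is a metric on the set where it is nondegenerate. -/
theorem isMetricOn_combination {U : Set (Fin N → ℝ)} {g₁ g₂ : MatrixField N} (c₁ c₂ : ℝ)
    (h₁ : IsMetricOn U g₁) (h₂ : IsMetricOn U g₂) :
    IsMetricOn {u ∈ U | (combination c₁ c₂ g₁ g₂ u).det ≠ 0} (combination c₁ c₂ g₁ g₂) where
  smooth i j := (contDiffOn_combination c₁ c₂ h₁ h₂ i j).mono fun _ h => h.1
  symm u hu := ((h₁.symm u hu.1).smul c₁).add ((h₂.symm u hu.1).smul c₂)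
  nondegenerate _ hu := hu.2

/-- Small `c` works by continuity at `c = 0`. The value `0` is excluded because a combination with a
zero coefficient carries no information about `S`. -/
theorem exists_combination_det_ne_zero {g₁ g₂ : MatrixField N} {u : Fin N → ℝ}
    (h : (g₂ u).det ≠ 0) : ∃ c : ℝ, c ≠ 0 ∧ (combination c 1 g₁ g₂ u).det ≠ 0 := by
  have hc : Continuous fun c : ℝ => (combination c 1 g₁ g₂ u).det := by
    unfold combination
    fun_prop
  have h0 : ∀ᶠ c : ℝ in 𝓝 0, (combination c 1 g₁ g₂ u).det ≠ 0 :=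
    hc.continuousAt.eventually_ne (by simpa [combination] using h)
  obtain ⟨c, hc, hc'⟩ :=
    ((h0.filter_mono nhdsWithin_le_nhds).and (self_mem_nhdsWithin (s := {0}ᶜ))).exists
  exact ⟨c, hc', hc⟩

section

variable {U : Set (Fin N → ℝ)} {g₁ g₂ : MatrixField N} {u : Fin N → ℝ}

theorem differenceMatrix_isSymm (hU : IsOpen U) (h₁ : IsMetricOn U g₁) (h₂ : IsMetricOn U g₂)
    (hu : u ∈ U) (j : Fin N) : (differenceMatrix g₁ g₂ j u).IsSymm :=
  (h₂.gammaMatrix_isSymm hU hu j).sub (h₁.gammaMatrix_isSymm hU hu j)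

/-- Twice the skew part of `(c₁ g₁ Γ₁ + c₂ g₂ Γ₂) (c₁ g₁ + c₂ g₂)`. -/
theorem skew_part_eq (c₁ c₂ : ℝ) (j : Fin N) (hU : IsOpen U) (h₁ : IsMetricOn U g₁)
    (h₂ : IsMetricOn U g₂) (hu : u ∈ U) :
    let X := (c₁ • (g₁ u * gammaMatrix g₁ j u) + c₂ • (g₂ u * gammaMatrix g₂ j u)) *
      combination c₁ c₂ g₁ g₂ u
    Xᵀ - X = (c₁ * c₂) • (g₁ u * differenceMatrix g₁ g₂ j u * g₂ u
      - g₂ u * differenceMatrix g₁ g₂ j u * g₁ u) := by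
  simp only [combination, differenceMatrix, Matrix.transpose_mul, Matrix.transpose_add,
    Matrix.transpose_smul, (h₁.symm u hu).eq, (h₂.symm u hu).eq,
    (h₁.gammaMatrix_isSymm hU hu j).eq, (h₂.gammaMatrix_isSymm hU hu j).eq]
  simp only [Matrix.add_mul, Matrix.mul_add, Matrix.sub_mul, Matrix.mul_sub, Matrix.smul_mul,
    Matrix.mul_smul, Matrix.mul_assoc]
  module

/-- The combined connection is torsion-free, so `g Γ^j g` has no skew part. By `skew_part_eq` this
part is also `c₁ c₂` times the skew part of `g₁ S^j g₂`. A single combination therefore suffices at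
each point. -/
theorem differenceSymmetricAt_of_connectionLinearAt {c₁ c₂ : ℝ} (hU : IsOpen U)
    (h₁ : IsMetricOn U g₁) (h₂ : IsMetricOn U g₂)
    (h : IsMetricOn U (combination c₁ c₂ g₁ g₂)) (hu : u ∈ U) (hc₁ : c₁ ≠ 0) (hc₂ : c₂ ≠ 0)
    (hlin : ConnectionLinearAt c₁ c₂ g₁ g₂ u) : DifferenceSymmetricAt g₁ g₂ u := by
  intro j
  have key := skew_part_eq c₁ c₂ j hU h₁ h₂ hu
  simp only [← connectionLinearAt_iff.1 hlin j] at key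
  rw [Matrix.transpose_mul, Matrix.transpose_mul, (h.symm u hu).eq,
    (h.gammaMatrix_isSymm hU hu j).eq, Matrix.mul_assoc, sub_self] at key
  exact sub_eq_zero.1 ((smul_eq_zero.1 key.symm).resolve_left (mul_ne_zero hc₁ hc₂))

/-- A tensor that is symmetric in one pair of indices and skew in an adjacent one vanishes. -/
theorem eq_zero_of_symm_of_skew {ι : Type*} {Y : ι → ι → ι → ℝ}
    (hs : ∀ j i m, Y j i m = Y j m i) (ha : ∀ j i m, Y j i m = -Y i j m) (j i m : ι) :
    Y j i m = 0 := by
  -- Alternating the two rules six times returns to `Y j i m` with the opposite sign.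
  linarith [hs j i m, ha j m i, hs m j i, ha m i j, hs i m j, ha i j m]

/-- Uniqueness of the Levi-Civita connection: the discrepancy `X` between the two sides is skew in
its upper indices by metricity, and `X j * g` is symmetric by zero torsion. Lowering to neither
index pair is needed, since `eq_zero_of_symm_of_skew` applies to `X j * g` directly. -/
theorem connectionLinearAt_of_differenceSymmetricAt {c₁ c₂ : ℝ} (hU : IsOpen U)
    (h₁ : IsMetricOn U g₁) (h₂ : IsMetricOn U g₂)
    (h : IsMetricOn U (combination c₁ c₂ g₁ g₂)) (hu : u ∈ U)
    (hD : DifferenceSymmetricAt g₁ g₂ u) : ConnectionLinearAt c₁ c₂ g₁ g₂ u := by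
  rw [connectionLinearAt_iff]
  set g := combination c₁ c₂ g₁ g₂ with hg
  set C : Fin N → Matrix (Fin N) (Fin N) ℝ := fun j =>
    c₁ • (g₁ u * gammaMatrix g₁ j u) + c₂ • (g₂ u * gammaMatrix g₂ j u) with hC
  set X : Fin N → Matrix (Fin N) (Fin N) ℝ := fun j => g u * gammaMatrix g j u - C j with hX
  have hskew : ∀ i j k, X j i k = -X i j k := fun i j k => by
    have e := h.pd_eq hU hu i j k
    have e₁ := h₁.pd_eq hU hu i j k
    have e₂ := h₂.pd_eq hU hu i j k
    have e' := pd_linear_combination k c₁ c₂ (h₁.entryDifferentiableAt hU hu i j)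
      (h₂.entryDifferentiableAt hU hu i j)
    have e'' : pd k (fun w => g w i j) u = pd k (fun w => c₁ * g₁ w i j + c₂ * g₂ w i j) u := rfl
    rw [e'', e', e₁, e₂] at e
    simp only [christoffelUp_eq] at e
    simp only [hX, hC, Matrix.sub_apply, Matrix.add_apply, Matrix.smul_apply, smul_eq_mul]
    linarith
  have hsymm : ∀ j, (X j * g u)ᵀ = X j * g u := fun j => by
    have key := skew_part_eq c₁ c₂ j hU h₁ h₂ hu
    simp only [hD j, sub_self, smul_zero] at key
    simp only [hX, Matrix.sub_mul, Matrix.transpose_sub]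
    rw [sub_eq_zero.1 key, Matrix.transpose_mul, Matrix.transpose_mul, (h.symm u hu).eq,
      (h.gammaMatrix_isSymm hU hu j).eq, Matrix.mul_assoc]
  intro j
  have hzero : X j * g u = 0 := by
    ext i m
    refine eq_zero_of_symm_of_skew (Y := fun j i m => (X j * g u) i m)
      (fun j i m => congrFun (congrFun (hsymm j).symm i) m) (fun j i m => ?_) j i m
    simp only [Matrix.mul_apply, ← Finset.sum_neg_distrib]
    exact Finset.sum_congr rfl fun k _ => by rw [hskew i j k, neg_mul]
  have : X j = X j * g u * (g u)⁻¹ := by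
    rw [Matrix.mul_assoc, Matrix.mul_nonsing_inv _ (h.isUnit_det hu), Matrix.mul_one]
  rw [hzero, Matrix.zero_mul] at this
  exact sub_eq_zero.1 this

/-! ### The curvature relation -/

/-- A complex matrix with `N` distinct eigenvalues has a commutative centralizer. -/
theorem commute_of_commute_of_ncard_eigenvalues {A X Y : Matrix (Fin N) (Fin N) ℂ}
    (hA : {z : ℂ | (A - z • (1 : Matrix (Fin N) (Fin N) ℂ)).det = 0}.ncard = N)
    (hX : Commute A X) (hY : Commute A Y) : Commute X Y := by
  set Z := {z : ℂ | (A - z • (1 : Matrix (Fin N) (Fin N) ℂ)).det = 0} with hZ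
  rcases Nat.eq_zero_or_pos N with rfl | hN
  -- For `N = 0` the cardinality hypothesis gives no finiteness, because `ncard` is `0` on infinite
  -- sets as well.
  · exact Subsingleton.elim _ _
  have hfin : Z.Finite := Set.finite_of_ncard_pos (hA.symm ▸ hN)
  have := hfin.fintype
  have hev : ∀ z : Z, ∃ e : Fin N → ℂ, e ≠ 0 ∧ A *ᵥ e = (z : ℂ) • e := fun z => by
    obtain ⟨e, he, h⟩ := Matrix.exists_mulVec_eq_zero_iff.2 z.2
    refine ⟨e, he, sub_eq_zero.1 ?_⟩
    rwa [Matrix.sub_mulVec, Matrix.smul_mulVec, Matrix.one_mulVec] at h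
  choose e he0 he using hev
  have hli : LinearIndependent ℂ e :=
    Module.End.eigenvectors_linearIndependent' (Matrix.toLin' A) (fun z : Z => (z : ℂ))
      Subtype.val_injective e fun z =>
        Module.End.hasEigenvector_iff.2 ⟨Module.End.mem_eigenspace_iff.2 (he z), he0 z⟩
  have hcard : Fintype.card Z = Module.finrank ℂ (Fin N → ℂ) := by
    rw [Module.finrank_fin_fun, ← Nat.card_eq_fintype_card]
    exact hA
  have : Nonempty Z := Fintype.card_pos_iff.1 (by rw [hcard, Module.finrank_fin_fun]; exact hN)
  let b := basisOfLinearIndependentOfCardEqFinrank hli hcard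
  have hb : ∀ z, b z = e z := fun z => by simp [b]
  -- `W` preserves each eigenspace of `A`, and these are lines, so the eigenbasis of `A`
  -- diagonalizes `W`.
  have hdiag : ∀ W : Matrix (Fin N) (Fin N) ℂ, Commute A W →
      ∀ z, ∃ c : ℂ, W *ᵥ e z = c • e z := fun W hW z => by
    refine ⟨b.repr (W *ᵥ e z) z, ?_⟩
    have h1 : A *ᵥ (W *ᵥ e z) = (z : ℂ) • (W *ᵥ e z) := by
      rw [Matrix.mulVec_mulVec, hW.eq, ← Matrix.mulVec_mulVec, he, Matrix.mulVec_smul]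
    have h2 : ∀ x, A *ᵥ x = ∑ y, (b.repr x y * (y : ℂ)) • b y := fun x => by
      conv_lhs => rw [← b.sum_repr x]
      rw [Matrix.mulVec_sum]
      exact Finset.sum_congr rfl fun y _ => by
        rw [Matrix.mulVec_smul, hb, he, smul_smul]
    have h3 : ∀ y, y ≠ z → b.repr (W *ᵥ e z) y = 0 := fun y hy => by
      have h4 := congrArg (fun x => b.repr x y) h1
      simp only [h2, b.repr_sum_self, map_smul, Finsupp.smul_apply, smul_eq_mul] at h4
      have h5 : b.repr (W *ᵥ e z) y * ((y : ℂ) - z) = 0 := by linear_combination h4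
      exact (mul_eq_zero.1 h5).resolve_right (sub_ne_zero.2 fun h => hy (Subtype.ext h))
    conv_lhs => rw [← b.sum_repr (W *ᵥ e z)]
    rw [Finset.sum_eq_single z (fun y _ hy => by rw [h3 y hy, zero_smul])
      (fun h => absurd (Finset.mem_univ z) h), hb]
  refine Matrix.toLin'.injective (b.ext fun z => ?_)
  obtain ⟨c, hc⟩ := hdiag X hX z
  obtain ⟨d, hd⟩ := hdiag Y hY z
  rw [hb, Matrix.toLin'_apply, Matrix.toLin'_apply, ← Matrix.mulVec_mulVec, ← Matrix.mulVec_mulVec,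
    hd, Matrix.mulVec_smul, hc, Matrix.mulVec_smul, hd, smul_comm]

/-- For a nonsingular pair, the centralizer of the affinor is commutative. -/
theorem NonsingularPair.commute (hns : NonsingularPair U g₁ g₂) (h₂ : IsMetricOn U g₂)
    (hu : u ∈ U) {X Y : Matrix (Fin N) (Fin N) ℝ} (hX : Commute (affinor g₁ g₂ u) X)
    (hY : Commute (affinor g₁ g₂ u) Y) : Commute X Y := by
  let φ : Matrix (Fin N) (Fin N) ℝ →+* Matrix (Fin N) (Fin N) ℂ := Complex.ofRealHom.mapMatrix
  have hφ : Function.Injective φ := Matrix.map_injective Complex.ofReal_injective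
  have hset : {z : ℂ | (φ (affinor g₁ g₂ u) - z • (1 : Matrix (Fin N) (Fin N) ℂ)).det = 0} =
      {z : ℂ | ((g₁ u).map Complex.ofReal - z • (g₂ u).map Complex.ofReal).det = 0} := by
    ext z
    have hmul : (g₁ u).map Complex.ofReal - z • (g₂ u).map Complex.ofReal =
        (φ (affinor g₁ g₂ u) - z • (1 : Matrix (Fin N) (Fin N) ℂ)) * φ (g₂ u) := by
      rw [sub_mul, smul_mul_assoc, one_mul, ← map_mul, affinor, mul_assoc,
        Matrix.nonsing_inv_mul _ (h₂.isUnit_det hu), mul_one]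
      rfl
    have hdet : (φ (g₂ u)).det ≠ 0 := by
      rw [← RingHom.map_det]
      exact Complex.ofReal_ne_zero.2 (h₂.nondegenerate u hu)
    simp only [Set.mem_ofPred_eq, hmul, Matrix.det_mul, mul_eq_zero, hdet, or_false]
  have := commute_of_commute_of_ncard_eigenvalues (hset ▸ hns u hu) (hX.map φ) (hY.map φ)
  exact hφ (by simpa only [map_mul] using this.eq)

/-- The symmetry of `S` is required on all of `U`, since linearity of the connection is
differentiated. Distinctness of the eigenvalues enters only through commutativity of the centralizer
of `v`. -/
theorem curvatureLinearAt_of_differenceSymmetricAt {c₁ c₂ : ℝ} (hU : IsOpen U)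
    (h₁ : IsMetricOn U g₁) (h₂ : IsMetricOn U g₂)
    (h : IsMetricOn U (combination c₁ c₂ g₁ g₂)) (hns : NonsingularPair U g₁ g₂) (hu : u ∈ U)
    (hD : ∀ w ∈ U, DifferenceSymmetricAt g₁ g₂ w) : CurvatureLinearAt c₁ c₂ g₁ g₂ u := by
  have hlin : ∀ w ∈ U, ConnectionLinearAt c₁ c₂ g₁ g₂ w := fun w hw =>
    connectionLinearAt_of_differenceSymmetricAt hU h₁ h₂ h hw (hD w hw)
  intro i j k l
  have hpd : ∀ k l, pd k (christoffelUp (combination c₁ c₂ g₁ g₂) i j l) u =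
      c₁ * pd k (christoffelUp g₁ i j l) u + c₂ * pd k (christoffelUp g₂ i j l) u := fun k l => by
    rw [← pd_linear_combination k c₁ c₂ (h₁.differentiableAt_christoffelUp hU hu i j l)
      (h₂.differentiableAt_christoffelUp hU hu i j l)]
    exact pd_congr (Filter.eventually_of_mem (hU.mem_nhds hu) fun w hw => hlin w hw i j l) k
  rw [h.riemannUp_eq hU hu, h₁.riemannUp_eq hU hu, h₂.riemannUp_eq hU hu, hpd, hpd]
  set g := combination c₁ c₂ g₁ g₂ with hg
  have hgu : g u = c₁ • g₁ u + c₂ • g₂ u := rfl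
  set S := fun j => differenceMatrix g₁ g₂ j u with hS
  have hSs : ∀ j, (S j)ᵀ = S j := fun j => differenceMatrix_isSymm hU h₁ h₂ hu j
  have hΓ₂ : ∀ j, gammaMatrix g₂ j u = gammaMatrix g₁ j u + S j := fun j =>
    (add_sub_cancel _ _).symm
  have hgg : g u * (g u)⁻¹ = 1 := Matrix.mul_nonsing_inv _ (h.isUnit_det hu)
  have hgg' : (g u)⁻¹ * g u = 1 := Matrix.nonsing_inv_mul _ (h.isUnit_det hu)
  have hg₂ : g₂ u * (g₂ u)⁻¹ = 1 := Matrix.mul_nonsing_inv _ (h₂.isUnit_det hu)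
  have hg₂' : (g₂ u)⁻¹ * g₂ u = 1 := Matrix.nonsing_inv_mul _ (h₂.isUnit_det hu)
  have hΓ : ∀ j, g u * gammaMatrix g j u = g u * gammaMatrix g₁ j u + c₂ • (g₂ u * S j) :=
      fun j => by
    rw [connectionLinearAt_iff.1 (hlin u hu) j, hΓ₂, hgu]
    simp only [Matrix.add_mul, Matrix.mul_add, Matrix.smul_mul]
    module
  have hΓ' : ∀ j, gammaMatrix g j u = gammaMatrix g₁ j u + c₂ • ((g u)⁻¹ * (g₂ u * S j)) :=
      fun j => by
    have := congrArg ((g u)⁻¹ * ·) (hΓ j)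
    simpa only [← Matrix.mul_assoc, Matrix.mul_add, Matrix.mul_smul, hgg', Matrix.one_mul]
      using this
  have hΓt : ∀ j, gammaMatrix g j u * g u = gammaMatrix g₁ j u * g u + c₂ • (S j * g₂ u) :=
      fun j => by
    have := congrArg Matrix.transpose (hΓ j)
    simpa only [Matrix.transpose_add, Matrix.transpose_smul, Matrix.transpose_mul,
      (h.symm u hu).eq, (h₂.symm u hu).eq, (h.gammaMatrix_isSymm hU hu j).eq,
      (h₁.gammaMatrix_isSymm hU hu j).eq, hSs] using this
  -- With `Γ₂ = Γ₁ + S`, the terms of `Γ^i g Γ^j` not quadratic in `S` match the linear combination.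
  -- `H` collects the quadratic ones: `c₂²` from the left side, `-c₂` from the `Γ₂` term.
  set H := c₂ ^ 2 • (g₂ u * (g u)⁻¹ * g₂ u) - c₂ • g₂ u with hH
  have hquad : gammaMatrix g i u * g u * gammaMatrix g j u =
      c₁ • (gammaMatrix g₁ i u * g₁ u * gammaMatrix g₁ j u)
        + c₂ • (gammaMatrix g₂ i u * g₂ u * gammaMatrix g₂ j u) + S i * H * S j := by
    have e : gammaMatrix g₁ i u * g u * ((g u)⁻¹ * (g₂ u * S j)) =
        gammaMatrix g₁ i u * (g₂ u * S j) := by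
      rw [Matrix.mul_assoc, ← Matrix.mul_assoc (g u), hgg, Matrix.one_mul]
    rw [hΓt, hΓ' j, Matrix.mul_add, Matrix.add_mul, Matrix.mul_smul, Matrix.add_mul, e, hΓ₂, hΓ₂,
      hH, hgu]
    simp only [Matrix.add_mul, Matrix.mul_add, Matrix.sub_mul, Matrix.mul_sub, Matrix.smul_mul,
      Matrix.mul_smul, Matrix.mul_assoc]
    module
  have hcS : ∀ j, Commute (affinor g₁ g₂ u) (g₂ u * S j) := fun j => by
    have e := congrArg (· * (g₂ u)⁻¹) (hD u hu j)
    simp only [Matrix.mul_assoc, hg₂, Matrix.mul_one] at e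
    change g₁ u * (g₂ u)⁻¹ * (g₂ u * S j) = g₂ u * S j * (g₁ u * (g₂ u)⁻¹)
    rw [Matrix.mul_assoc, ← Matrix.mul_assoc (g₂ u)⁻¹, hg₂', Matrix.one_mul, Matrix.mul_assoc]
    exact e
  -- This matrix is the inverse of `g g₂⁻¹ = c₁ v + c₂`, a polynomial in `v`.
  have hcg : Commute (affinor g₁ g₂ u) (g₂ u * (g u)⁻¹) := by
    have e1 : g u * (g₂ u)⁻¹ = c₁ • affinor g₁ g₂ u + c₂ • 1 := by
      rw [hgu, Matrix.add_mul, Matrix.smul_mul, Matrix.smul_mul, hg₂]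
      rfl
    have e2 : Commute (affinor g₁ g₂ u) (g u * (g₂ u)⁻¹) := by
      rw [e1]
      exact ((Commute.refl _).smul_right _).add_right ((Commute.one_right _).smul_right _)
    have e3 : g u * (g₂ u)⁻¹ * (g₂ u * (g u)⁻¹) = 1 := by
      rw [Matrix.mul_assoc, ← Matrix.mul_assoc (g₂ u)⁻¹, hg₂', Matrix.one_mul, hgg]
    have e4 : g₂ u * (g u)⁻¹ * (g u * (g₂ u)⁻¹) = 1 := mul_eq_one_comm.1 e3
    let q : (Matrix (Fin N) (Fin N) ℝ)ˣ := ⟨_, _, e3, e4⟩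
    exact Commute.units_inv_right (u := q) e2
  have hsymm : (S i * H * S j)ᵀ = S i * H * S j := by
    have hHt : Hᵀ = H := by
      simp only [hH, Matrix.transpose_sub, Matrix.transpose_smul, Matrix.transpose_mul,
        (h₂.symm u hu).eq, Matrix.transpose_nonsing_inv, (h.symm u hu).eq, Matrix.mul_assoc]
    have hSH : ∀ i j, S i * H * S j = (g₂ u)⁻¹ * ((g₂ u * S i) *
        ((c₂ ^ 2 • (g₂ u * (g u)⁻¹) - c₂ • 1) * (g₂ u * S j))) := fun i j => by
      have : H = (c₂ ^ 2 • (g₂ u * (g u)⁻¹) - c₂ • 1) * g₂ u := by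
        rw [Matrix.sub_mul, Matrix.smul_mul, Matrix.smul_mul, Matrix.one_mul]
      rw [this, ← Matrix.mul_assoc (g₂ u)⁻¹, ← Matrix.mul_assoc (g₂ u)⁻¹, hg₂', Matrix.one_mul]
      simp only [Matrix.mul_assoc]
    rw [Matrix.transpose_mul, Matrix.transpose_mul, hSs, hSs, hHt, ← Matrix.mul_assoc, hSH, hSH]
    have hK : Commute (affinor g₁ g₂ u) (c₂ ^ 2 • (g₂ u * (g u)⁻¹) - c₂ • 1) :=
      (hcg.smul_right _).sub_right ((Commute.one_right _).smul_right _)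
    have hij := (hns.commute h₂ hu (hcS i) (hcS j)).eq
    have hjK := (hns.commute h₂ hu (hcS j) hK).eq
    have hiK := (hns.commute h₂ hu (hcS i) hK).eq
    congr 1
    rw [← Matrix.mul_assoc, hjK, Matrix.mul_assoc, ← hij, ← Matrix.mul_assoc, ← hiK,
      Matrix.mul_assoc]
  have hkl : (S i * H * S j) l k = (S i * H * S j) k l := congrFun (congrFun hsymm k) l
  rw [hquad]
  simp only [Matrix.add_apply, Matrix.smul_apply, smul_eq_mul, hkl]
  ring

end

/-! ### The Nijenhuis tensor -/

/-- The derivative `x^k ∂_k A` of a matrix field in the direction `x`. -/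
noncomputable def dirDeriv (A : MatrixField N) (u x : Fin N → ℝ) : Matrix (Fin N) (Fin N) ℝ :=
  ∑ k, x k • pdMatrix k A u

/-- The vector with components `x^s M^j_{sk} y^k`. -/
def vecForm (M : Fin N → Matrix (Fin N) (Fin N) ℝ) (x y : Fin N → ℝ) : Fin N → ℝ :=
  fun j => x ⬝ᵥ (M j *ᵥ y)

theorem vecForm_comm {M : Fin N → Matrix (Fin N) (Fin N) ℝ} (hM : ∀ j, (M j).IsSymm)
    (x y : Fin N → ℝ) : vecForm M x y = vecForm M y x := by
  ext j
  rw [vecForm, vecForm, dotProduct_comm, ← Matrix.vecMul_transpose, (hM j).eq,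
    ← Matrix.dotProduct_mulVec]

theorem vecForm_sub (M M' : Fin N → Matrix (Fin N) (Fin N) ℝ) (x y : Fin N → ℝ) :
    vecForm (fun j => M j - M' j) x y = vecForm M x y - vecForm M' x y := by
  ext j
  simp [vecForm, Matrix.sub_mulVec]

theorem dotProduct_dirDeriv_mulVec (A : MatrixField N) (u x a b : Fin N → ℝ) :
    a ⬝ᵥ (dirDeriv A u x *ᵥ b) =
      ∑ i, ∑ j, ∑ k, a i * b j * x k * pd k (fun w => A w i j) u := by
  simp only [dotProduct, Matrix.mulVec, dirDeriv, pdMatrix, Matrix.sum_apply, Matrix.smul_apply,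
    Matrix.of_apply, smul_eq_mul, Finset.sum_mul, Finset.mul_sum]
  exact Finset.sum_congr rfl fun i _ => Finset.sum_congr rfl fun j _ =>
    Finset.sum_congr rfl fun k _ => by ring

theorem dotProduct_vecForm_gammaMatrix {g : MatrixField N} {u : Fin N → ℝ} (hg : (g u).IsSymm)
    (a b x : Fin N → ℝ) :
    b ⬝ᵥ vecForm (fun j => gammaMatrix g j u) (g u *ᵥ a) x =
      ∑ i, ∑ j, ∑ k, a i * b j * x k * christoffelUp g i j k u := by
  have h : ∀ j, (g u *ᵥ a) ⬝ᵥ (gammaMatrix g j u *ᵥ x) =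
      a ⬝ᵥ ((g u * gammaMatrix g j u) *ᵥ x) := fun j => by
    rw [← Matrix.mulVec_mulVec, Matrix.dotProduct_mulVec a, ← Matrix.mulVec_transpose, hg.eq]
  have h' : vecForm (fun j => gammaMatrix g j u) (g u *ᵥ a) x =
      fun j => a ⬝ᵥ ((g u * gammaMatrix g j u) *ᵥ x) := funext h
  rw [h']
  simp only [christoffelUp_eq, dotProduct, Matrix.mulVec, Finset.mul_sum]
  rw [Finset.sum_comm]
  exact Finset.sum_congr rfl fun i _ => Finset.sum_congr rfl fun j _ =>
    Finset.sum_congr rfl fun k _ => by ring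

theorem IsMetricOn.dirDeriv_eq {U : Set (Fin N → ℝ)} {g : MatrixField N} {u : Fin N → ℝ}
    (h : IsMetricOn U g) (hU : IsOpen U) (hu : u ∈ U) (x a b : Fin N → ℝ) :
    a ⬝ᵥ (dirDeriv g u x *ᵥ b) =
      -(b ⬝ᵥ vecForm (fun j => gammaMatrix g j u) (g u *ᵥ a) x
        + a ⬝ᵥ vecForm (fun j => gammaMatrix g j u) (g u *ᵥ b) x) := by
  rw [dotProduct_dirDeriv_mulVec, dotProduct_vecForm_gammaMatrix (h.symm u hu),
    dotProduct_vecForm_gammaMatrix (h.symm u hu),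
    Finset.sum_comm (f := fun i j => ∑ k, b i * a j * x k * christoffelUp g i j k u)]
  simp only [← Finset.sum_add_distrib, ← Finset.sum_neg_distrib, h.pd_eq hU hu]
  exact Finset.sum_congr rfl fun i _ => Finset.sum_congr rfl fun j _ =>
    Finset.sum_congr rfl fun k _ => by ring

/-- The Nijenhuis tensor contracted with a covector `ξ` and two vectors `x`, `y`. -/
theorem sum_nijenhuis_eq (v : MatrixField N) (u ξ x y : Fin N → ℝ) :
    ∑ k, ∑ i, ∑ j, ξ k * x i * y j * nijenhuis v k i j u =
      ξ ⬝ᵥ (dirDeriv v u (v u *ᵥ x) *ᵥ y) - ξ ⬝ᵥ (dirDeriv v u (v u *ᵥ y) *ᵥ x)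
        + (ξ ᵥ* v u) ⬝ᵥ (dirDeriv v u y *ᵥ x) - (ξ ᵥ* v u) ⬝ᵥ (dirDeriv v u x *ᵥ y) := by
  have h1 : ∀ x y : Fin N → ℝ, ξ ⬝ᵥ (dirDeriv v u (v u *ᵥ x) *ᵥ y) =
      ∑ k, ∑ i, ∑ j, ∑ s, ξ k * x i * y j * (v u s i * pd s (fun w => v w k j) u) :=
      fun x y => by
    rw [dotProduct_dirDeriv_mulVec]
    refine Finset.sum_congr rfl fun k _ => ?_
    rw [Finset.sum_comm (f := fun i j => ∑ s, ξ k * x i * y j * _)]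
    refine Finset.sum_congr rfl fun j _ => ?_
    rw [Finset.sum_comm]
    refine Finset.sum_congr rfl fun s _ => ?_
    simp only [Matrix.mulVec, dotProduct, Finset.mul_sum, Finset.sum_mul]
    exact Finset.sum_congr rfl fun i _ => by ring
  have h2 : ∀ x y : Fin N → ℝ, (ξ ᵥ* v u) ⬝ᵥ (dirDeriv v u y *ᵥ x) =
      ∑ k, ∑ i, ∑ j, ∑ s, ξ k * x i * y j * (v u k s * pd j (fun w => v w s i) u) :=
      fun x y => by
    rw [dotProduct_dirDeriv_mulVec, Finset.sum_comm,
      Finset.sum_comm (f := fun k i => ∑ j, ∑ s, ξ k * x i * y j * _)]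
    refine Finset.sum_congr rfl fun i _ => ?_
    rw [Finset.sum_comm, Finset.sum_comm (f := fun k j => ∑ s, ξ k * x i * y j * _)]
    refine Finset.sum_congr rfl fun j _ => ?_
    rw [Finset.sum_comm (f := fun k s => ξ k * x i * y j * _)]
    refine Finset.sum_congr rfl fun s _ => ?_
    simp only [Matrix.vecMul, dotProduct, Finset.sum_mul]
    exact Finset.sum_congr rfl fun k _ => by ring
  rw [h1 x y, h1 y x, h2 x y, h2 y x]
  rw [← Finset.sum_sub_distrib, ← Finset.sum_add_distrib, ← Finset.sum_sub_distrib]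
  refine Finset.sum_congr rfl fun k _ => ?_
  rw [Finset.sum_comm (f := fun i j => ∑ s, ξ k * y i * x j * (v u s i * _)),
    Finset.sum_comm (f := fun i j => ∑ s, ξ k * y i * x j * (v u k s * _))]
  simp only [← Finset.sum_sub_distrib, ← Finset.sum_add_distrib]
  refine Finset.sum_congr rfl fun i _ => Finset.sum_congr rfl fun j _ => ?_
  rw [nijenhuis, Finset.mul_sum]
  exact Finset.sum_congr rfl fun s _ => by ring

section

variable {U : Set (Fin N → ℝ)} {g₁ g₂ : MatrixField N} {u : Fin N → ℝ}

theorem dirDeriv_mul {A B : MatrixField N} (hA : EntryDifferentiableAt A u)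
    (hB : EntryDifferentiableAt B u) (x : Fin N → ℝ) :
    dirDeriv (fun w => A w * B w) u x = dirDeriv A u x * B u + A u * dirDeriv B u x := by
  simp only [dirDeriv, pdMatrix_mul _ hA hB, smul_add, Finset.sum_add_distrib, Matrix.sum_mul,
    Matrix.mul_sum, Matrix.smul_mul, Matrix.mul_smul]

theorem affinor_mul (h₂ : IsMetricOn U g₂) (hu : u ∈ U) : affinor g₁ g₂ u * g₂ u = g₁ u := by
  rw [affinor, Matrix.mul_assoc, Matrix.nonsing_inv_mul _ (h₂.isUnit_det hu), Matrix.mul_one]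

theorem dirDeriv_affinor_mul (hU : IsOpen U) (h₁ : IsMetricOn U g₁) (h₂ : IsMetricOn U g₂)
    (hu : u ∈ U) (x : Fin N → ℝ) :
    dirDeriv (affinor g₁ g₂) u x * g₂ u =
      dirDeriv g₁ u x - affinor g₁ g₂ u * dirDeriv g₂ u x := by
  have hdiff : EntryDifferentiableAt (affinor g₁ g₂) u := fun i j => by
    simp only [affinor, Matrix.mul_apply]
    exact DifferentiableAt.fun_sum fun s _ =>
      (h₁.entryDifferentiableAt hU hu i s).fun_mul (h₂.entryDifferentiableAt_inv hU hu s j)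
  have hmul : dirDeriv (fun w => affinor g₁ g₂ w * g₂ w) u x = dirDeriv g₁ u x :=
    Finset.sum_congr rfl fun k _ => by
      rw [pdMatrix_congr (Filter.eventually_of_mem (hU.mem_nhds hu) fun w hw =>
        affinor_mul h₂ hw) k]
  rw [← hmul, dirDeriv_mul hdiff (h₂.entryDifferentiableAt hU hu), add_sub_cancel_right]

/-- The tensor `g₁^{is} S^k_{sp} g₂^{pj}` as a trilinear form in covectors. -/
noncomputable def differenceForm (g₁ g₂ : MatrixField N) (u a b c : Fin N → ℝ) : ℝ :=
  c ⬝ᵥ vecForm (fun j => differenceMatrix g₁ g₂ j u) (g₁ u *ᵥ a) (g₂ u *ᵥ b)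

/-- Metricity of both connections is applied to `(Dv) g₂ = Dg₁ - v Dg₂`. Since `g₂ (ξ v) = g₁ ξ`,
two of the terms evaluate `Γ₁` and `Γ₂` on the same vectors and merge into `S`. -/
theorem dotProduct_dirDeriv_affinor (hU : IsOpen U) (h₁ : IsMetricOn U g₁)
    (h₂ : IsMetricOn U g₂) (hu : u ∈ U) (x b ξ : Fin N → ℝ) :
    ξ ⬝ᵥ (dirDeriv (affinor g₁ g₂) u x *ᵥ (g₂ u *ᵥ b)) =
      b ⬝ᵥ vecForm (fun j => differenceMatrix g₁ g₂ j u) (g₁ u *ᵥ ξ) x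
        - ξ ⬝ᵥ vecForm (fun j => gammaMatrix g₁ j u) (g₁ u *ᵥ b) x
        + (ξ ᵥ* affinor g₁ g₂ u) ⬝ᵥ vecForm (fun j => gammaMatrix g₂ j u) (g₂ u *ᵥ b) x := by
  have hξ : g₂ u *ᵥ (ξ ᵥ* affinor g₁ g₂ u) = g₁ u *ᵥ ξ := by
    rw [← (h₂.symm u hu).eq, Matrix.mulVec_transpose, Matrix.vecMul_vecMul, affinor_mul h₂ hu,
      ← Matrix.mulVec_transpose, (h₁.symm u hu).eq]
  rw [Matrix.mulVec_mulVec, dirDeriv_affinor_mul hU h₁ h₂ hu, Matrix.sub_mulVec, dotProduct_sub,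
    ← Matrix.mulVec_mulVec, Matrix.dotProduct_mulVec ξ (affinor g₁ g₂ u),
    h₁.dirDeriv_eq hU hu, h₂.dirDeriv_eq hU hu, hξ]
  simp only [differenceMatrix, vecForm_sub, dotProduct_sub]
  ring

/-- The contraction of the Nijenhuis tensor of the affinor, in terms of the difference tensor of
the two Levi-Civita connections. -/
theorem sum_nijenhuis_affinor_eq (hU : IsOpen U) (h₁ : IsMetricOn U g₁) (h₂ : IsMetricOn U g₂)
    (hu : u ∈ U) (a b ξ : Fin N → ℝ) :
    let ζ := ξ ᵥ* affinor g₁ g₂ u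
    ∑ k, ∑ i, ∑ j, ξ k * (g₂ u *ᵥ a) i * (g₂ u *ᵥ b) j * nijenhuis (affinor g₁ g₂) k i j u =
      differenceForm g₁ g₂ u a ζ b - differenceForm g₁ g₂ u b ζ a
        + differenceForm g₁ g₂ u ζ b a - differenceForm g₁ g₂ u ζ a b
        + differenceForm g₁ g₂ u a b ζ - differenceForm g₁ g₂ u b a ζ := by
  intro ζ
  have hζ : g₁ u *ᵥ ξ = g₂ u *ᵥ ζ := by
    rw [← (h₂.symm u hu).eq, Matrix.mulVec_transpose, Matrix.vecMul_vecMul, affinor_mul h₂ hu,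
      ← Matrix.mulVec_transpose, (h₁.symm u hu).eq]
  have hv : ∀ a, affinor g₁ g₂ u *ᵥ (g₂ u *ᵥ a) = g₁ u *ᵥ a := fun a => by
    rw [Matrix.mulVec_mulVec, affinor_mul h₂ hu]
  rw [sum_nijenhuis_eq, hv, hv]
  simp only [dotProduct_dirDeriv_affinor hU h₁ h₂ hu, hζ]
  have hS := vecForm_comm (differenceMatrix_isSymm hU h₁ h₂ hu)
  have hΓ₁ := vecForm_comm (h₁.gammaMatrix_isSymm hU hu)
  have hΓ₂ := vecForm_comm (h₂.gammaMatrix_isSymm hU hu)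
  have hsub : ∀ x y, vecForm (fun j => differenceMatrix g₁ g₂ j u) x y =
      vecForm (fun j => gammaMatrix g₂ j u) x y - vecForm (fun j => gammaMatrix g₁ j u) x y :=
    fun x y => vecForm_sub _ _ x y
  -- Torsion-freeness aligns the arguments: the terms `Γ₁(g₁ b, g₁ a)` and `Γ₂(g₂ b, g₂ a)` cancel,
  -- and the mixed terms paired with `ζ` combine into `S`.
  rw [hS (g₂ u *ᵥ ζ) (g₁ u *ᵥ a), hS (g₂ u *ᵥ ζ) (g₁ u *ᵥ b), hΓ₁ (g₁ u *ᵥ b) (g₁ u *ᵥ a),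
    hΓ₂ (g₂ u *ᵥ b) (g₁ u *ᵥ a), hΓ₂ (g₂ u *ᵥ a) (g₁ u *ᵥ b), hΓ₂ (g₂ u *ᵥ b) (g₂ u *ᵥ a)]
  simp only [differenceForm]
  rw [hsub (g₁ u *ᵥ a) (g₂ u *ᵥ b), hsub (g₁ u *ᵥ b) (g₂ u *ᵥ a), dotProduct_sub, dotProduct_sub]
  ring

theorem differenceSymmetricAt_iff_differenceForm (hU : IsOpen U) (h₁ : IsMetricOn U g₁)
    (h₂ : IsMetricOn U g₂) (hu : u ∈ U) :
    DifferenceSymmetricAt g₁ g₂ u ↔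
      ∀ a b c, differenceForm g₁ g₂ u a b c = differenceForm g₁ g₂ u b a c := by
  have h12 : ∀ a b j, (g₁ u *ᵥ a) ⬝ᵥ (differenceMatrix g₁ g₂ j u *ᵥ (g₂ u *ᵥ b)) =
      a ⬝ᵥ ((g₁ u * differenceMatrix g₁ g₂ j u * g₂ u) *ᵥ b) := fun a b j => by
    rw [Matrix.mul_assoc, ← Matrix.mulVec_mulVec, ← Matrix.mulVec_mulVec,
      Matrix.dotProduct_mulVec a, ← Matrix.mulVec_transpose, (h₁.symm u hu).eq]
  have h21 : ∀ a b j, (g₁ u *ᵥ b) ⬝ᵥ (differenceMatrix g₁ g₂ j u *ᵥ (g₂ u *ᵥ a)) =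
      a ⬝ᵥ ((g₂ u * differenceMatrix g₁ g₂ j u * g₁ u) *ᵥ b) := fun a b j => by
    have ht : g₂ u * differenceMatrix g₁ g₂ j u * g₁ u =
        (g₁ u * differenceMatrix g₁ g₂ j u * g₂ u)ᵀ := by
      rw [Matrix.transpose_mul, Matrix.transpose_mul, (h₁.symm u hu).eq, (h₂.symm u hu).eq,
        (differenceMatrix_isSymm hU h₁ h₂ hu j).eq, Matrix.mul_assoc]
    rw [h12, ht, Matrix.dotProduct_mulVec a, Matrix.vecMul_transpose, dotProduct_comm]
  constructor
  · intro h a b c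
    rw [differenceForm, differenceForm]
    congr 1
    ext j
    rw [vecForm, vecForm, h12, h21, h j]
  · intro h j
    ext i k
    have := h (Pi.single i 1) (Pi.single k 1) (Pi.single j 1)
    rw [differenceForm, differenceForm, single_one_dotProduct, single_one_dotProduct, vecForm,
      vecForm, h12, h21] at this
    simpa using this

/-- The Nijenhuis tensor of the affinor vanishes at a point if and only if the difference tensor
of the two connections has the symmetry `DifferenceSymmetricAt`. -/
theorem nijenhuis_affinor_eq_zero_iff (hU : IsOpen U) (h₁ : IsMetricOn U g₁)
    (h₂ : IsMetricOn U g₂) (hu : u ∈ U) :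
    (∀ k i j, nijenhuis (affinor g₁ g₂) k i j u = 0) ↔ DifferenceSymmetricAt g₁ g₂ u := by
  rw [differenceSymmetricAt_iff_differenceForm hU h₁ h₂ hu]
  have key := sum_nijenhuis_affinor_eq hU h₁ h₂ hu
  constructor
  · intro hN
    have hcyc : ∀ a b c, differenceForm g₁ g₂ u a c b - differenceForm g₁ g₂ u b c a
        + differenceForm g₁ g₂ u c b a - differenceForm g₁ g₂ u c a b
        + differenceForm g₁ g₂ u a b c - differenceForm g₁ g₂ u b a c = 0 := fun a b c => by
      have hdet : IsUnit (affinor g₁ g₂ u).det := by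
        rw [affinor, Matrix.det_mul]
        exact (h₁.isUnit_det hu).mul (Matrix.isUnit_nonsing_inv_det _ (h₂.isUnit_det hu))
      -- As `v` is invertible, `ζ = ξ v` can be made an arbitrary covector `c`.
      have e := key a b (c ᵥ* (affinor g₁ g₂ u)⁻¹)
      simp only [hN, mul_zero, Finset.sum_const_zero, Matrix.vecMul_vecMul,
        Matrix.nonsing_inv_mul _ hdet, Matrix.vecMul_one] at e
      exact e.symm
    intro a b c
    -- For the skew parts `P`, `Q`, `R` at the three rotations of `(a, b, c)`, these read `P = Q +
    -- R`, `Q = R + P`, `R = P + Q`, hence all vanish.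
    linarith [hcyc a b c, hcyc b c a, hcyc c a b]
  · intro hD k i j
    have hg : ∀ x, g₂ u *ᵥ ((g₂ u)⁻¹ *ᵥ x) = x := fun x => by
      rw [Matrix.mulVec_mulVec, Matrix.mul_nonsing_inv _ (h₂.isUnit_det hu), Matrix.one_mulVec]
    have e := key ((g₂ u)⁻¹ *ᵥ Pi.single i 1) ((g₂ u)⁻¹ *ᵥ Pi.single j 1) (Pi.single k 1)
    simp only [hg] at e
    set a := (g₂ u)⁻¹ *ᵥ Pi.single i (1 : ℝ)
    set b := (g₂ u)⁻¹ *ᵥ Pi.single j (1 : ℝ)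
    set ζ := Pi.single k (1 : ℝ) ᵥ* affinor g₁ g₂ u
    rw [hD a ζ b, hD b ζ a, hD a b ζ] at e
    simp only [Pi.single_apply, ite_mul, mul_ite, one_mul, mul_one, zero_mul, mul_zero,
      Finset.sum_ite_eq', Finset.mem_univ, if_true] at e
    rw [e]
    ring

/-! ### Passage to the open set where a combination is nondegenerate, and conclusion. -/

theorem AlmostCompatible.differenceSymmetricAt (hc : AlmostCompatible U g₁ g₂) (hU : IsOpen U)
    (h₁ : IsMetricOn U g₁) (h₂ : IsMetricOn U g₂) (hu : u ∈ U) :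
    DifferenceSymmetricAt g₁ g₂ u := by
  obtain ⟨c, hc0, hdet⟩ := exists_combination_det_ne_zero (g₁ := g₁) (h₂.nondegenerate u hu)
  have hsub : {w ∈ U | (combination c 1 g₁ g₂ w).det ≠ 0} ⊆ U := fun _ h => h.1
  exact differenceSymmetricAt_of_connectionLinearAt
    (isOpen_det_ne_zero hU (contDiffOn_combination c 1 h₁ h₂)) (h₁.mono hsub) (h₂.mono hsub)
    (isMetricOn_combination c 1 h₁ h₂) ⟨hu, hdet⟩ hc0 one_ne_zero (hc c 1 u hu hdet)

theorem compatible_of_differenceSymmetricAt (hU : IsOpen U) (h₁ : IsMetricOn U g₁)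
    (h₂ : IsMetricOn U g₂) (hns : NonsingularPair U g₁ g₂)
    (hD : ∀ w ∈ U, DifferenceSymmetricAt g₁ g₂ w) : Compatible U g₁ g₂ := by
  intro c₁ c₂ u hu hdet
  have hsub : {w ∈ U | (combination c₁ c₂ g₁ g₂ w).det ≠ 0} ⊆ U := fun _ h => h.1
  have hopen := isOpen_det_ne_zero hU (contDiffOn_combination c₁ c₂ h₁ h₂)
  have hmetric := isMetricOn_combination c₁ c₂ h₁ h₂
  exact ⟨connectionLinearAt_of_differenceSymmetricAt hopen (h₁.mono hsub) (h₂.mono hsub) hmetric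
      ⟨hu, hdet⟩ (hD u hu),
    curvatureLinearAt_of_differenceSymmetricAt hopen (h₁.mono hsub) (h₂.mono hsub) hmetric
      (fun w hw => hns w (hsub hw)) ⟨hu, hdet⟩ fun w hw => hD w (hsub hw)⟩

theorem Compatible.almostCompatible (h : Compatible U g₁ g₂) : AlmostCompatible U g₁ g₂ :=
  fun c₁ c₂ u hu hdet => (h c₁ c₂ u hu hdet).1

theorem AlmostCompatible.nijenhuisVanishes (hc : AlmostCompatible U g₁ g₂) (hU : IsOpen U)
    (h₁ : IsMetricOn U g₁) (h₂ : IsMetricOn U g₂) : NijenhuisVanishes U (affinor g₁ g₂) :=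
  fun _ hu => (nijenhuis_affinor_eq_zero_iff hU h₁ h₂ hu).2
    (hc.differenceSymmetricAt hU h₁ h₂ hu)

end

end MetricPencil

theorem theorem4 {N : ℕ} (U : Set (Fin N → ℝ)) (hU : IsOpen U)
    (g₁ g₂ : MetricPencil.MatrixField N)
    (h₁ : MetricPencil.IsMetricOn U g₁) (h₂ : MetricPencil.IsMetricOn U g₂) :
    ((MetricPencil.AlmostCompatible U g₁ g₂ →
        MetricPencil.NijenhuisVanishes U (MetricPencil.affinor g₁ g₂)) ∧
      (MetricPencil.Compatible U g₁ g₂ →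
        MetricPencil.NijenhuisVanishes U (MetricPencil.affinor g₁ g₂))) ∧
    (MetricPencil.NonsingularPair U g₁ g₂ →
      (MetricPencil.NijenhuisVanishes U (MetricPencil.affinor g₁ g₂) →
        MetricPencil.Compatible U g₁ g₂) ∧
      (MetricPencil.Compatible U g₁ g₂ ↔ MetricPencil.AlmostCompatible U g₁ g₂)) := by
  refine ⟨⟨fun h => h.nijenhuisVanishes hU h₁ h₂,
    fun h => h.almostCompatible.nijenhuisVanishes hU h₁ h₂⟩, fun hns => ⟨fun hN => ?_,
    fun h => h.almostCompatible, fun h => ?_⟩⟩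
  · exact MetricPencil.compatible_of_differenceSymmetricAt hU h₁ h₂ hns fun w hw =>
      (MetricPencil.nijenhuis_affinor_eq_zero_iff hU h₁ h₂ hw).1 (hN w hw)
  · exact MetricPencil.compatible_of_differenceSymmetricAt hU h₁ h₂ hns fun w hw =>
      h.differenceSymmetricAt hU h₁ h₂ hw
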